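/- Let $\mathcal{A}$ be a finite set of action symbols, let $\tau\notin\mathcal{A}$, and put $\mathcal{A}_\tau=\mathcal{A}\cup\{\tau\}$. A *transition system* $T=(S,\to,\uparrow,\downarrow)$ consists of a set of states $S$, a relation $\to\subseteq S\times\mathcal{A}_\tau\times S$, an initial state $\uparrow\in S$ and a set of final states $\downarrow\subseteq S$. It is *deterministic* if $s\xrightarrow{a}s_1$ and $s\xrightarrow{a}s_2$ imply $s_1=s_2$ for all $a\in\mathcal{A}_\tau$, and $s\xrightarrow{\tau}s_1$ implies that $s$ has no outgoing $a$-transition with $a\neq\tau$. It is *computable* if every set $\mathit{out}(s)=\{(a,t)\mid s\xrightarrow{a}t\}$ is finite and there are injections $\mathcal{A}_\tau\to\mathbb{N}$ and $S\to\mathbb{N}$ (codings), the latter written $s\mapsto\ulcorner s\urcorner$, such that the partial functions on $\mathbb{N}$ that map $\ulcorner s\urcorner$ to the code of the finite set $\mathit{out}(s)$ (using the standard codings of pairs and of finite sets of natural numbers) and to the value at $s$ of the characteristic function of $\downarrow$, respectively, and that are undefined on all numbers that are not codes of states, are partial recursive. A *reactive Turing machine* (RTM) over a finite set $\mathcal{D}$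 of data symbols, with $\mathcal{D}_\square=\mathcal{D}\cup\{\square\}$ where $\square\notin\mathcal{D}$ is the blank, consists of a finite set of states $Q$, a transition relation $\to\subseteq Q\times\mathcal{D}_\square\times\mathcal{A}_\tau\times\mathcal{D}_\square\times\{L,R\}\times Q$, an initial state and a set of final states. A transition $(s,d,a,e,M,t)$ means: in state $s$, reading $d$, execute $a$, write $e$, move the head one cell in direction $M$, and go to state $t$. The RTM is *deterministic* if $(s,d,a,e_1,M_1,t_1),(s,d,a,e_2,M_2,t_2)\in{\to}$ implies $e_1=e_2$, $M_1=M_2$, $t_1=t_2$, and $(s,d,\tau,e_1,M_1,t_1)\in{\to}$ implies that there is no $(s,d,a,e_2,M_2,t_2)\in{\to}$ with $a\neq\tau$. Its transition system $\mathcal{T}(M)$ has as states the pairs of a state in $Q$ and a two-way infinite tape with a head position and only finitely many non-blank cells (considered up to translation), has the transitions induced by the transition relation, starts in the initial state with an empty tape, and has as final states the configurations whose state is final. A *branching bisimulation* from $T_1$ to $T_2$ is a relation $R\subseteq S_1\times S_2$ such that $s_1\mathrel{R}s_2$ implies: 1. if $s_1\xrightarrow{a}s_1'$, then there are $s_2'',s_2'$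 with $s_2\xrightarrow{\tau}{}^{*}s_2''$, $s_1\mathrel{R}s_2''$, $s_1'\mathrel{R}s_2'$, and either $s_2''\xrightarrow{a}s_2'$, or $a=\tau$ and $s_2''=s_2'$; 2. if $s_1$ is final, then there is a final $s_2'$ with $s_2\xrightarrow{\tau}{}^{*}s_2'$ and $s_1\mathrel{R}s_2'$; 3. the symmetric versions of 1 and 2, with the roles of $T_1$ and $T_2$ exchanged. It is *divergence-preserving* if moreover, whenever $s_1\mathrel{R}s_2$ and there is an infinite sequence $s_1=s_{1,0}\xrightarrow{\tau}s_{1,1}\xrightarrow{\tau}\cdots$ with $s_{1,i}\mathrel{R}s_2$ for all $i$, there are $s_2'$ and $i$ with $s_2\xrightarrow{\tau}{}^{+}s_2'$ and $s_{1,i}\mathrel{R}s_2'$; and symmetrically. Two transition systems are *divergence-preserving branching bisimilar* if some divergence-preserving branching bisimulation from the first to the second relates their initial states. **Corollary.** For every deterministic computable transition system $T$ over $\mathcal{A}_\tau$ there exist a finite set of data symbols and a deterministic RTM $M$ over it, with action symbols $\mathcal{A}$, such that $\mathcal{T}(M)$ and $T$ are divergence-preserving branching bisimilar. -/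

import Mathlib

universe u v w

/-- The actions in `Act` together with the unobservable action `τ`: `none` is `τ`,
and `some a` is the observable action `a`. -/
abbrev ActTau (Act : Type u) : Type u := Option Act

/-- The unobservable action. -/
abbrev tau {Act : Type u} : ActTau Act := none

/-! ### Labelled transition systems -/

/-- A transition system labelled with `Act ∪ {τ}`. -/
structure TransitionSystem (Act : Type u) where
  State : Type v
  step : State → ActTau Act → State → Prop
  init : State
  final : Set State

namespace TransitionSystem

variable {Act : Type u}

/-- The set of outgoing transitions of a state. -/
def out (T : TransitionSystem.{u, v} Act) (s : T.State) : Set (ActTau Act × T.State) :=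
  {p | T.step s p.1 p.2}

def FinitelyBranching (T : TransitionSystem.{u, v} Act) : Prop :=
  ∀ s, (T.out s).Finite

def Deterministic (T : TransitionSystem.{u, v} Act) : Prop :=
  (∀ s a s₁ s₂, T.step s a s₁ → T.step s a s₂ → s₁ = s₂) ∧
  (∀ s s₁, T.step s tau s₁ → ¬ ∃ a s₂, a ≠ tau ∧ T.step s a s₂)

/-- The relation `s ⟶τ t`. -/
def tauStep (T : TransitionSystem.{u, v} Act) (s t : T.State) : Prop :=
  T.step s tau t

/-- The reflexive-transitive closure of `⟶τ`. -/
def tauSteps (T : TransitionSystem.{u, v} Act) : T.State → T.State → Prop :=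
  Relation.ReflTransGen T.tauStep

/-- The transitive closure of `⟶τ`. -/
def tauStepsPlus (T : TransitionSystem.{u, v} Act) : T.State → T.State → Prop :=
  Relation.TransGen T.tauStep

/-- The relation `s ⟶(a) t`: an `a`-step, or no step at all if `a = τ`. -/
def optStep (T : TransitionSystem.{u, v} Act) (s : T.State) (a : ActTau Act)
    (t : T.State) : Prop :=
  T.step s a t ∨ (a = tau ∧ s = t)

end TransitionSystem

/-! ### Branching bisimilarity -/

section Bisimulation

variable {Act : Type u}

structure IsBranchingBisimulation (T₁ : TransitionSystem.{u, v} Act)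
    (T₂ : TransitionSystem.{u, w} Act) (R : T₁.State → T₂.State → Prop) : Prop where
  forth : ∀ s₁ s₂, R s₁ s₂ → ∀ a s₁', T₁.step s₁ a s₁' →
    ∃ s₂'' s₂', T₂.tauSteps s₂ s₂'' ∧ T₂.optStep s₂'' a s₂' ∧ R s₁ s₂'' ∧ R s₁' s₂'
  back : ∀ s₁ s₂, R s₁ s₂ → ∀ a s₂', T₂.step s₂ a s₂' →
    ∃ s₁'' s₁', T₁.tauSteps s₁ s₁'' ∧ T₁.optStep s₁'' a s₁' ∧ R s₁'' s₂ ∧ R s₁' s₂'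
  final_forth : ∀ s₁ s₂, R s₁ s₂ → s₁ ∈ T₁.final →
    ∃ s₂', T₂.tauSteps s₂ s₂' ∧ R s₁ s₂' ∧ s₂' ∈ T₂.final
  final_back : ∀ s₁ s₂, R s₁ s₂ → s₂ ∈ T₂.final →
    ∃ s₁', T₁.tauSteps s₁ s₁' ∧ R s₁' s₂ ∧ s₁' ∈ T₁.final

structure IsDivergencePreserving (T₁ : TransitionSystem.{u, v} Act)
    (T₂ : TransitionSystem.{u, w} Act) (R : T₁.State → T₂.State → Prop) : Prop where
  forth : ∀ s₁ s₂, R s₁ s₂ → ∀ σ : ℕ → T₁.State, σ 0 = s₁ →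
    (∀ i, T₁.tauStep (σ i) (σ (i + 1))) → (∀ i, R (σ i) s₂) →
    ∃ s₂', T₂.tauStepsPlus s₂ s₂' ∧ ∃ i, R (σ i) s₂'
  back : ∀ s₁ s₂, R s₁ s₂ → ∀ σ : ℕ → T₂.State, σ 0 = s₂ →
    (∀ i, T₂.tauStep (σ i) (σ (i + 1))) → (∀ i, R s₁ (σ i)) →
    ∃ s₁', T₁.tauStepsPlus s₁ s₁' ∧ ∃ i, R s₁' (σ i)

/-- Divergence-preserving branching bisimilarity of transition systems. -/
def DivPresBranchingBisimilar (T₁ : TransitionSystem.{u, v} Act)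
    (T₂ : TransitionSystem.{u, w} Act) : Prop :=
  ∃ R : T₁.State → T₂.State → Prop,
    IsBranchingBisimulation T₁ T₂ R ∧ IsDivergencePreserving T₁ T₂ R ∧ R T₁.init T₂.init

end Bisimulation

/-! ### Computable transition systems -/

/-- The canonical index `2 ^ x₁ + ⋯ + 2 ^ xₖ` of a finite set `{x₁, …, xₖ}` of natural numbers. -/
noncomputable def finiteSetCode (X : Set ℕ) (hX : X.Finite) : ℕ :=
  ∑ x ∈ hX.toFinset, 2 ^ x

/-- `f : S → ℕ` is recursive with respect to the coding `code` of `S`: the partial function on `ℕ`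
that maps `code s` to `f s` for every `s`, and is undefined on all numbers that are not codes, is
partial recursive. -/
def RecursiveUnderCoding {S : Type v} (code : S → ℕ) (f : S → ℕ) : Prop :=
  ∃ g : ℕ →. ℕ, Nat.Partrec g ∧ (∀ s, g (code s) = Part.some (f s)) ∧
    ∀ n, n ∉ Set.range code → g n = Part.none

namespace TransitionSystem

variable {Act : Type u}

/-- The code of the finite set `out s`, given codings of actions and of states. -/
noncomputable def outCode (T : TransitionSystem.{u, v} Act) (hT : T.FinitelyBranching)
    (codeAct : ActTau Act → ℕ) (codeState : T.State → ℕ) (s : T.State) : ℕ :=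
  finiteSetCode ((fun p => Nat.pair (codeAct p.1) (codeState p.2)) '' T.out s) ((hT s).image _)

open Classical in
/-- The characteristic function of the set of final states. -/
noncomputable def fin (T : TransitionSystem.{u, v} Act) (s : T.State) : ℕ :=
  if s ∈ T.final then 1 else 0

/-- A finitely branching transition system is computable if, for some codings (injections into `ℕ`)
of its actions and of its states, `out` and `fin` are recursive functions. -/
def IsComputable (T : TransitionSystem.{u, v} Act) : Prop :=
  ∃ hT : T.FinitelyBranching,
    ∃ (codeAct : ActTau Act → ℕ) (codeState : T.State → ℕ),
      Function.Injective codeAct ∧ Function.Injective codeState ∧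
      RecursiveUnderCoding codeState (T.outCode hT codeAct codeState) ∧
      RecursiveUnderCoding codeState T.fin

end TransitionSystem

/-! ### Reactive Turing machines -/

/-- The data symbols together with the blank: `none` is the blank, which is also the `default`
element, i.e. the blank of Mathlib tapes over `TapeSymbol Data`. -/
abbrev TapeSymbol (Data : Type w) : Type w := Option Data

/-- A reactive Turing machine with action symbols `Act` and data symbols `Data`.
`trans s d a e M t` says that in state `s`, reading `d`, the machine may execute the action `a`,
write `e`, move the head in direction `M`, and go to state `t`. -/
structure RTM (Act : Type u) (Data : Type w) where
  State : Type v
  finite_state : Finite State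
  trans : State → TapeSymbol Data → ActTau Act → TapeSymbol Data → Turing.Dir → State → Prop
  init : State
  final : Set State

namespace RTM

variable {Act : Type u} {Data : Type w}

def Deterministic (M : RTM.{u, v, w} Act Data) : Prop :=
  (∀ s d a e₁ e₂ M₁ M₂ t₁ t₂, M.trans s d a e₁ M₁ t₁ → M.trans s d a e₂ M₂ t₂ →
    e₁ = e₂ ∧ t₁ = t₂ ∧ M₁ = M₂) ∧
  (∀ s d e₁ M₁ t₁, M.trans s d tau e₁ M₁ t₁ →
    ¬ ∃ a e₂ M₂ t₂, a ≠ tau ∧ M.trans s d a e₂ M₂ t₂)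

/-- Configurations: a state and a tape instance. A `Turing.Tape` is a two-way infinite tape with a
marked head cell and finitely many non-blank cells, i.e. a finite sequence of tape symbols with one
marked symbol, up to adding or removing blanks at its two ends. -/
abbrev Config (M : RTM.{u, v, w} Act Data) : Type (max v w) :=
  M.State × Turing.Tape (TapeSymbol Data)

/-- The transition system associated with a reactive Turing machine. Its initial configuration has
an empty tape; a configuration is final if its state is. -/
def lts (M : RTM.{u, v, w} Act Data) : TransitionSystem.{u, max v w} Act where
  State := M.Config
  step c a c' := ∃ e dir, M.trans c.1 c.2.head a e dir c'.1 ∧ c'.2 = (c.2.write e).move dir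
  init := (M.init, default)
  final := {c | c.1 ∈ M.final}

end RTM

/-!
The machine keeps the code of the current state `s` of `T` on its tape. Between two actions of `T`
it silently computes, question by question, whether `s` is final and which actions `s` enables, and
collects the answers in its finite control. It then rests in a control state that offers exactly
these actions; executing one of them starts the computation of the code of the successor of `s`.

These internal computations terminate, are deterministic, and pass through non-final configurations
only. So relating a configuration to `s` when it silently reaches a resting configuration for `s`
gives a branching bisimulation. It preserves divergence: an infinite silent run of the machine must
leave a resting configuration by a `τ` offered there, hence by a `τ`-step of `T`, and every
`τ`-step of `T` costs the machine at least one step.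
-/

open Turing

universe x

/-! ### Silent refinements -/

namespace TransitionSystem

variable {Act : Type u}

/-- A silent step out of a state that is not final. -/
def SilentStep (T : TransitionSystem.{u, v} Act) (c c' : T.State) : Prop :=
  c ∉ T.final ∧ T.tauStep c c'

/-- Reachability by silent steps out of states that are not final; the last state may be final. -/
def SilentReach (T : TransitionSystem.{u, v} Act) : T.State → T.State → Prop :=
  Relation.ReflTransGen T.SilentStep

theorem SilentReach.tauSteps {T : TransitionSystem.{u, v} Act} {c c' : T.State}
    (h : T.SilentReach c c') : T.tauSteps c c' :=
  Relation.ReflTransGen.mono (fun _ _ h => h.2) _ _ h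

theorem Deterministic.exists_apply_eq_of_tauSteps {T : TransitionSystem.{u, v} Act}
    (hT : T.Deterministic) {σ : ℕ → T.State} (hσ : ∀ i, T.tauStep (σ i) (σ (i + 1)))
    {d : T.State} (hd : T.tauSteps (σ 0) d) : ∃ j, σ j = d := by
  induction hd with
  | refl => exact ⟨0, rfl⟩
  | tail _ hstep ih =>
    obtain ⟨j, rfl⟩ := ih
    exact ⟨j + 1, hT.1 _ _ _ _ (hσ j) hstep⟩

end TransitionSystem

/-- `D` relates the resting states of an implementation `T₁` to the states of `T₂` they stand for:
they agree on finality and on the enabled actions, and after each action `T₁` silently reaches a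
resting state again. Between resting states the silent steps of `T₁` are its internal computation,
which `T₂` does not see. -/
structure IsSilentRefinement {Act : Type u} (T₁ : TransitionSystem.{u, v} Act)
    (T₂ : TransitionSystem.{u, w} Act) (D : T₁.State → T₂.State → Prop) : Prop where
  init : ∃ d, T₁.SilentReach T₁.init d ∧ D d T₂.init
  mem_final_iff : ∀ {d s}, D d s → (d ∈ T₁.final ↔ s ∈ T₂.final)
  forth : ∀ {d s a c}, D d s → T₁.step d a c →
    ∃ t, T₂.step s a t ∧ ∃ d', T₁.SilentReach c d' ∧ D d' t
  back : ∀ {d s a t}, D d s → T₂.step s a t →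
    ∃ c, T₁.step d a c ∧ ∃ d', T₁.SilentReach c d' ∧ D d' t

namespace IsSilentRefinement

variable {Act : Type u}

section Comp

variable {T₁ : TransitionSystem.{u, v} Act} {T₂ : TransitionSystem.{u, w} Act}
  {T₃ : TransitionSystem.{u, x} Act} {D : T₁.State → T₂.State → Prop}
  {E : T₂.State → T₃.State → Prop}

theorem exists_silentReach (h : IsSilentRefinement T₁ T₂ D) {d : T₁.State} {s s' : T₂.State}
    (hD : D d s) (hs : T₂.SilentReach s s') : ∃ d', T₁.SilentReach d d' ∧ D d' s' := by
  induction hs with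
  | refl => exact ⟨d, .refl, hD⟩
  | tail _ hstep ih =>
    obtain ⟨d₁, hd₁, hD₁⟩ := ih
    obtain ⟨c, hc, d₂, hd₂, hD₂⟩ := h.back hD₁ hstep.2
    have hsilent : T₁.SilentStep d₁ c := ⟨mt (h.mem_final_iff hD₁).1 hstep.1, hc⟩
    exact ⟨d₂, (hd₁.tail hsilent).trans hd₂, hD₂⟩

theorem comp (h₁ : IsSilentRefinement T₁ T₂ D) (h₂ : IsSilentRefinement T₂ T₃ E) :
    IsSilentRefinement T₁ T₃ (Relation.Comp D E) where
  init := by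
    obtain ⟨d, hd, hD⟩ := h₁.init
    obtain ⟨m, hm, hE⟩ := h₂.init
    obtain ⟨d', hd', hD'⟩ := h₁.exists_silentReach hD hm
    exact ⟨d', hd.trans hd', m, hD', hE⟩
  mem_final_iff := fun ⟨_, hD, hE⟩ => (h₁.mem_final_iff hD).trans (h₂.mem_final_iff hE)
  forth := by
    rintro d s a c ⟨m, hD, hE⟩ hstep
    obtain ⟨m₁, hm₁, d₁, hd₁, hD₁⟩ := h₁.forth hD hstep
    obtain ⟨t, ht, m₂, hm₂, hE₂⟩ := h₂.forth hE hm₁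
    obtain ⟨d₂, hd₂, hD₂⟩ := h₁.exists_silentReach hD₁ hm₂
    exact ⟨t, ht, d₂, hd₁.trans hd₂, m₂, hD₂, hE₂⟩
  back := by
    rintro d s a t ⟨m, hD, hE⟩ hstep
    obtain ⟨m₁, hm₁, m₂, hm₂, hE₂⟩ := h₂.back hE hstep
    obtain ⟨c, hc, d₁, hd₁, hD₁⟩ := h₁.back hD hm₁
    obtain ⟨d₂, hd₂, hD₂⟩ := h₁.exists_silentReach hD₁ hm₂
    exact ⟨c, hc, d₂, hd₁.trans hd₂, m₂, hD₂, hE₂⟩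

end Comp

variable {T₁ : TransitionSystem.{u, v} Act} {T₂ : TransitionSystem.{u, w} Act}
  {D : T₁.State → T₂.State → Prop}

theorem isBranchingBisimulation (h : IsSilentRefinement T₁ T₂ D) (hT₁ : T₁.Deterministic) :
    IsBranchingBisimulation T₁ T₂ (Relation.Comp T₁.SilentReach D) where
  forth := by
    rintro c s ⟨d, hcd, hD⟩ a c' hstep
    rcases Relation.ReflTransGen.cases_head hcd with rfl | ⟨c₁, hcc₁, hc₁d⟩
    · obtain ⟨t, ht, hR⟩ := h.forth hD hstep
      exact ⟨s, t, .refl, .inl ht, ⟨c, .refl, hD⟩, hR⟩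
    · have ha : a = tau := by
        by_contra ha
        exact hT₁.2 _ _ hcc₁.2 ⟨a, c', ha, hstep⟩
      subst ha
      obtain rfl := hT₁.1 _ _ _ _ hstep hcc₁.2
      exact ⟨s, s, .refl, .inr ⟨rfl, rfl⟩, ⟨d, hcd, hD⟩, ⟨d, hc₁d, hD⟩⟩
  back := by
    rintro c s ⟨d, hcd, hD⟩ a t hstep
    obtain ⟨c', hc', hR⟩ := h.back hD hstep
    exact ⟨d, c', hcd.tauSteps, .inl hc', ⟨d, .refl, hD⟩, hR⟩
  final_forth := by
    rintro c s ⟨d, hcd, hD⟩ hc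
    rcases Relation.ReflTransGen.cases_head hcd with rfl | ⟨c₁, hcc₁, -⟩
    · exact ⟨s, .refl, ⟨c, .refl, hD⟩, (h.mem_final_iff hD).1 hc⟩
    · exact absurd hc hcc₁.1
  final_back := by
    rintro c s ⟨d, hcd, hD⟩ hs
    exact ⟨d, hcd.tauSteps, ⟨d, .refl, hD⟩, (h.mem_final_iff hD).2 hs⟩

theorem isDivergencePreserving (h : IsSilentRefinement T₁ T₂ D) (hT₁ : T₁.Deterministic) :
    IsDivergencePreserving T₁ T₂ (Relation.Comp T₁.SilentReach D) where
  forth := by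
    rintro _ s ⟨d, hcd, hD⟩ σ rfl hσ -
    obtain ⟨j, rfl⟩ := hT₁.exists_apply_eq_of_tauSteps hσ hcd.tauSteps
    obtain ⟨t, ht, hR⟩ := h.forth hD (hσ j)
    exact ⟨t, .single ht, j + 1, hR⟩
  back := by
    rintro c _ ⟨d, hcd, hD⟩ σ rfl hσ -
    obtain ⟨c', hc', hR⟩ := h.back hD (hσ 0)
    exact ⟨c', Relation.TransGen.tail' hcd.tauSteps hc', 1, hR⟩

theorem divPresBranchingBisimilar (h : IsSilentRefinement T₁ T₂ D) (hT₁ : T₁.Deterministic) :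
    DivPresBranchingBisimilar T₁ T₂ :=
  ⟨_, h.isBranchingBisimulation hT₁, h.isDivergencePreserving hT₁, h.init⟩

end IsSilentRefinement

theorem RTM.Deterministic.lts {Act : Type u} {Data : Type w} {M : RTM.{u, v, w} Act Data}
    (h : M.Deterministic) : M.lts.Deterministic := by
  refine ⟨?_, ?_⟩
  · rintro s a s₁ s₂ ⟨e₁, d₁, h₁, t₁⟩ ⟨e₂, d₂, h₂, t₂⟩
    obtain ⟨rfl, hs, rfl⟩ := h.1 _ _ _ _ _ _ _ _ _ h₁ h₂
    exact Prod.ext hs (t₁.trans t₂.symm)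
  · rintro s s₁ ⟨e₁, d₁, h₁, -⟩ ⟨a, s₂, ha, e₂, d₂, h₂, -⟩
    exact h.2 _ _ _ _ _ h₁ ⟨a, e₂, d₂, _, ha, h₂⟩

/-- The condition that determinism puts on the actions a state offers: a state that offers `τ`
offers nothing else. Here `f a` is the effect of the action `a` if it is offered. -/
def TauExclusive {Act : Type u} {β : Type*} (f : ActTau Act → Option β) : Prop :=
  ∀ a, a ≠ tau → (f tau).isSome → f a = none

/-! ### Machines whose head may stay in place -/

/-- A reactive machine with a deterministic transition function, whose head may also stay in place
(`none` as its direction), and whose blank is the default symbol of its alphabet. Post–Turing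
machines, which move or write but never both, are run more easily by such a machine than by an
`RTM`. -/
structure StayRTM (Act : Type u) (Γ : Type w) where
  State : Type v
  finite_state : Finite State
  trans : State → Γ → ActTau Act → Option (Γ × Option Dir × State)
  init : State
  final : Set State

namespace StayRTM

variable {Act : Type u} {Γ : Type w} [Inhabited Γ]

/-- Move the head of a tape, or keep it in place. -/
def moveOrStay (t : Tape Γ) (o : Option Dir) : Tape Γ :=
  o.elim t (t.move ·)

/-- The transition system of a machine with optional head moves. -/
def lts (N : StayRTM.{u, v, w} Act Γ) : TransitionSystem.{u, max v w} Act where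
  State := N.State × Tape Γ
  step c a c' := ∃ b o, N.trans c.1 c.2.head a = some (b, o, c'.1) ∧
    c'.2 = moveOrStay (c.2.write b) o
  init := (N.init, default)
  final := {c | c.1 ∈ N.final}

theorem silentStep_write {N : StayRTM.{u, v, w} Act Γ} {s s' : N.State} {t : Tape Γ} {b : Γ}
    (hs : s ∉ N.final) (h : N.trans s t.head tau = some (b, none, s')) :
    N.lts.SilentStep (s, t) (s', t.write b) :=
  ⟨hs, b, none, h, rfl⟩

theorem silentStep_move {N : StayRTM.{u, v, w} Act Γ} {s s' : N.State} {t : Tape Γ} {dir : Dir}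
    (hs : s ∉ N.final) (h : N.trans s t.head tau = some (t.head, some dir, s')) :
    N.lts.SilentStep (s, t) (s', t.move dir) :=
  ⟨hs, t.head, some dir, h, by rw [Tape.write_self]; rfl⟩

/-- The reactive Turing machine executing `N`. A step that keeps the head in place is executed as a
move to the right followed by a silent move to the left, and the second component of the state
records that this move to the left is pending. -/
def toRTM (N : StayRTM.{u, v, w} Act Γ) : RTM.{u, v, w} Act Γ where
  State := N.State × Bool
  finite_state := have := N.finite_state; inferInstance
  trans s d a e m t :=
    (s.2 = false ∧ ∃ b o, N.trans s.1 (d.getD default) a = some (b, o, t.1) ∧ e = some b ∧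
      m = o.getD .right ∧ t.2 = o.isNone) ∨
    (s.2 = true ∧ a = tau ∧ e = d ∧ m = .left ∧ t = (s.1, false))
  init := (N.init, false)
  final := {s | s.2 = false ∧ s.1 ∈ N.final}

theorem toRTM_deterministic {N : StayRTM.{u, v, w} Act Γ}
    (hN : ∀ s b, TauExclusive (N.trans s b)) : N.toRTM.Deterministic := by
  refine ⟨?_, ?_⟩
  · rintro ⟨s, _⟩ d a e₁ e₂ M₁ M₂ ⟨t₁, x₁⟩ ⟨t₂, x₂⟩
      (⟨rfl, b₁, o₁, h₁, rfl, rfl, rfl⟩ | ⟨rfl, rfl, rfl, rfl, ht₁⟩)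
      (⟨hs, b₂, o₂, h₂, rfl, rfl, rfl⟩ | ⟨hs, -, rfl, rfl, ht₂⟩)
    · cases h₁.symm.trans h₂
      exact ⟨rfl, rfl, rfl⟩
    · cases hs
    · cases hs
    · exact ⟨rfl, ht₁.trans ht₂.symm, rfl⟩
  · rintro ⟨s, _⟩ d e₁ M₁ ⟨t₁, x₁⟩ (⟨rfl, b₁, o₁, h₁, -⟩ | ⟨rfl, -⟩)
      ⟨a, e₂, M₂, ⟨t₂, x₂⟩, ha, (⟨hs, b₂, o₂, h₂, -⟩ | ⟨-, ha', -⟩)⟩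
    · rw [hN _ _ a ha (Option.isSome_of_eq_some h₁)] at h₂
      cases h₂
    · exact ha ha'
    · cases hs
    · exact ha ha'

/-- An `RTM` has a blank besides the symbols of its alphabet; read it as the default symbol. -/
def forgetBlank (Γ : Type w) [Inhabited Γ] : PointedMap (TapeSymbol Γ) Γ :=
  ⟨fun a => a.getD default, rfl⟩

variable {N : StayRTM.{u, v, w} Act Γ}

/-- The configuration `c` of `N.toRTM` stands for the configuration `x` of `N`, with no move
pending. -/
def Represents (N : StayRTM.{u, v, w} Act Γ) (c : N.toRTM.lts.State) (x : N.lts.State) : Prop :=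
  c.1 = (x.1, false) ∧ c.2.map (forgetBlank Γ) = x.2

theorem exists_silentReach_represents (s : N.State) (t : Tape (TapeSymbol Γ)) (o : Option Dir) :
    ∃ d, N.toRTM.lts.SilentReach ((s, o.isNone), t.move (o.getD .right)) d ∧
      N.Represents d (s, moveOrStay (t.map (forgetBlank Γ)) o) := by
  cases o with
  | none =>
    refine ⟨((s, false), t), .single ⟨fun h => Bool.noConfusion h.1, ?_⟩, rfl, rfl⟩
    refine ⟨(t.move .right).head, .left, .inr ⟨rfl, rfl, rfl, rfl, rfl⟩, ?_⟩
    simp [Tape.write_self]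
  | some dir => exact ⟨_, .refl, rfl, Tape.map_move _ _ _⟩

theorem Represents.step_toRTM_iff {c c' : N.toRTM.lts.State} {x : N.lts.State} {a : ActTau Act}
    (h : N.Represents c x) : N.toRTM.lts.step c a c' ↔
      ∃ b o s', N.trans x.1 x.2.head a = some (b, o, s') ∧
        c' = ((s', o.isNone), (c.2.write (some b)).move (o.getD .right)) := by
  obtain ⟨⟨s, p⟩, t⟩ := c
  obtain ⟨⟨s', p'⟩, t'⟩ := c'
  obtain ⟨x, y⟩ := x
  obtain ⟨hs, ht : t.map (forgetBlank Γ) = y⟩ := h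
  cases hs
  subst ht
  rw [Tape.map_fst]
  constructor
  · rintro ⟨_, _, ⟨-, b, o, htrans, rfl, rfl, rfl⟩ | ⟨hp, -⟩, rfl⟩
    · exact ⟨b, o, s', htrans, rfl⟩
    · cases hp
  · rintro ⟨b, o, s'', htrans, heq⟩
    cases heq
    exact ⟨_, _, .inl ⟨rfl, b, o, htrans, rfl, rfl, rfl⟩, rfl⟩

theorem Represents.exists_silentReach {c : N.toRTM.lts.State} {x : N.lts.State}
    (h : N.Represents c x) (s : N.State) (b : Γ) (o : Option Dir) :
    ∃ d, N.toRTM.lts.SilentReach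
        ((s, o.isNone), (c.2.write (some b)).move (o.getD .right)) d ∧
      N.Represents d (s, moveOrStay (x.2.write b) o) := by
  have hwrite : (c.2.write (some b)).map (forgetBlank Γ) = x.2.write b :=
    h.2 ▸ Tape.map_write _ _ _
  exact hwrite ▸ exists_silentReach_represents s (c.2.write (some b)) o

theorem isSilentRefinement_represents (N : StayRTM.{u, v, w} Act Γ) :
    IsSilentRefinement N.toRTM.lts N.lts N.Represents where
  init := ⟨N.toRTM.lts.init, .refl, rfl, rfl⟩
  mem_final_iff := by
    rintro ⟨⟨s, p⟩, t⟩ ⟨x, y⟩ ⟨hs, -⟩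
    cases hs
    exact ⟨fun h => h.2, fun h => ⟨rfl, h⟩⟩
  forth := by
    rintro c x a c' hR hstep
    obtain ⟨b, o, s', htrans, rfl⟩ := hR.step_toRTM_iff.1 hstep
    exact ⟨(s', moveOrStay (x.2.write b) o), ⟨b, o, htrans, rfl⟩,
      hR.exists_silentReach s' b o⟩
  back := by
    rintro c x a ⟨s', t'⟩ hR ⟨b, o, htrans, rfl⟩
    exact ⟨_, hR.step_toRTM_iff.2 ⟨b, o, s', htrans, rfl⟩, hR.exists_silentReach s' b o⟩

end StayRTM

/-! ### Reactive programs with subroutines -/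

/-- A Post–Turing machine with finitely many labels, which is run from its default label. -/
structure FiniteTM0 (Γ : Type w) where
  Label : Type v
  inhabited_label : Inhabited Label
  finite_label : Finite Label
  machine : TM0.Machine Γ Label

namespace FiniteTM0

variable {Γ : Type w}

instance (m : FiniteTM0.{v, w} Γ) : Inhabited m.Label := m.inhabited_label

instance (m : FiniteTM0.{v, w} Γ) : Finite m.Label := m.finite_label

variable [Inhabited Γ]

/-- Started on the tape `t`, the machine halts with the tape `t'`. -/
def Transforms (m : FiniteTM0.{v, w} Γ) (t t' : Tape Γ) : Prop :=
  ∃ c ∈ StateTransition.eval (TM0.step m.machine) ⟨default, t⟩, c.Tape = t'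

theorem tape_map_id (t : Tape Γ) : t.map (⟨id, rfl⟩ : PointedMap Γ Γ) = t := by
  have hmap (l : ListBlank Γ) : l.map (⟨id, rfl⟩ : PointedMap Γ Γ) = l :=
    ListBlank.ext fun i => ListBlank.nth_map _ l i
  simp only [Tape.map, hmap, id]

open Classical in
/-- A machine all of whose reachable labels lie in the finite set `S`, as a machine with
finitely many labels. -/
noncomputable def restrict {Λ : Type v} [Inhabited Λ] (M : TM0.Machine Γ Λ) {S : Set Λ}
    (hfin : S.Finite) (hS : TM0.Supports M S) : FiniteTM0.{v, w} Γ where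
  Label := S
  inhabited_label := ⟨⟨default, hS.1⟩⟩
  finite_label := hfin
  machine :=
    letI : Inhabited S := ⟨⟨default, hS.1⟩⟩
    M.map ⟨id, rfl⟩ ⟨id, rfl⟩ (fun q => if h : q ∈ S then ⟨q, h⟩ else default) Subtype.val

theorem restrict_transforms {Λ : Type v} [Inhabited Λ] {M : TM0.Machine Γ Λ} {S : Set Λ}
    (hfin : S.Finite) (hS : TM0.Supports M S) {t : Tape Γ} {c : TM0.Cfg Γ Λ}
    (hc : c ∈ StateTransition.eval (TM0.step M) ⟨default, t⟩) :
    (restrict M hfin hS).Transforms t c.Tape := by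
  classical
  let : Inhabited S := ⟨⟨default, hS.1⟩⟩
  let toSubtype : PointedMap Λ S :=
    ⟨fun q => if h : q ∈ S then ⟨q, h⟩ else default, dif_pos hS.1⟩
  have hrespects := M.map_respects ⟨id, rfl⟩ ⟨id, rfl⟩ toSubtype Subtype.val hS
    (fun _ => rfl) (fun q hq => congrArg Subtype.val (dif_pos hq))
  have hstart : TM0.Cfg.map ⟨id, rfl⟩ toSubtype ⟨default, t⟩ = ⟨default, t⟩ :=
    congr (congrArg TM0.Cfg.mk toSubtype.map_pt) (tape_map_id t)
  obtain ⟨_, ⟨-, rfl⟩, hc'⟩ := StateTransition.tr_eval hrespects ⟨hS.1, hstart⟩ hc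
  exact ⟨_, hc', tape_map_id c.Tape⟩

end FiniteTM0

/-- A finite control that alternates between running subroutines on a tape and offering actions.
A query `p` runs `subroutine p` and then continues with `next p b`, where `b` is the symbol one cell
to the right of the head. A ready state offers the actions at which `react` is defined. Before the
query `start`, the symbol `seed` is written on the empty tape. -/
structure ReactiveProgram (Act : Type u) (Γ : Type w) where
  Query : Type v
  Ready : Type v
  finite_query : Finite Query
  finite_ready : Finite Ready
  subroutine : Query → FiniteTM0.{v, w} Γ
  next : Query → Γ → Query ⊕ Ready
  seed : Γ
  start : Query
  react : Ready → ActTau Act → Option Query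
  final : Set Ready

namespace ReactiveProgram

variable {Act : Type u} {Γ : Type w}

instance (P : ReactiveProgram.{u, v, w} Act Γ) : Finite P.Query := P.finite_query

instance (P : ReactiveProgram.{u, v, w} Act Γ) : Finite P.Ready := P.finite_ready

/-- The control states of the machine executing `P`: `boot` is about to write the seed, `run p l` is
at the label `l` of the subroutine of `p`, and `branch p` has just moved right to read the symbol on
which `P.next p` depends. -/
inductive Control (P : ReactiveProgram.{u, v, w} Act Γ) : Type v
  | boot : Control P
  | run (p : P.Query) (l : (P.subroutine p).Label) : Control P
  | branch (p : P.Query) : Control P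
  | ready (e : P.Ready) : Control P

instance (P : ReactiveProgram.{u, v, w} Act Γ) : Finite P.Control :=
  Finite.of_injective (β := Option ((Σ p, (P.subroutine p).Label) ⊕ P.Query ⊕ P.Ready))
    (fun
      | .boot => none
      | .run p l => some (.inl ⟨p, l⟩)
      | .branch p => some (.inr (.inl p))
      | .ready e => some (.inr (.inr e)))
    (by rintro (_ | _ | _ | _) (_ | _ | _ | _) <;> simp)

/-- The control state in which the machine executing `P` enters a query or a ready state. -/
def entry (P : ReactiveProgram.{u, v, w} Act Γ) : P.Query ⊕ P.Ready → P.Control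
  | .inl p => .run p default
  | .inr e => .ready e

/-- The transition function of the machine executing `P`. -/
def trans (P : ReactiveProgram.{u, v, w} Act Γ) :
    P.Control → Γ → ActTau Act → Option (Γ × Option Dir × P.Control)
  | .boot, _, none => some (P.seed, none, P.entry (.inl P.start))
  | .run p l, b, none =>
    match (P.subroutine p).machine l b with
    | none => some (b, some .right, .branch p)
    | some (l', .move d) => some (b, some d, .run p l')
    | some (l', .write b') => some (b', none, .run p l')
  | .branch p, b, none => some (b, some .left, P.entry (P.next p b))
  | .ready e, b, a => (P.react e a).map fun p => (b, none, P.entry (.inl p))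
  | _, _, some _ => none

theorem tauExclusive_trans {P : ReactiveProgram.{u, v, w} Act Γ}
    (hP : ∀ e, TauExclusive (P.react e)) (s : P.Control) (b : Γ) : TauExclusive (P.trans s b) := by
  intro a ha h
  obtain ⟨a, rfl⟩ := Option.ne_none_iff_exists'.1 ha
  cases s with
  | ready e =>
    simp only [trans, Option.isSome_map, Option.map_eq_none_iff] at h ⊢
    exact hP e _ ha h
  | _ => rfl

variable [Inhabited Γ]

/-- The machine executing `P`. -/
def toStayRTM (P : ReactiveProgram.{u, v, w} Act Γ) : StayRTM.{u, v, w} Act Γ where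
  State := P.Control
  finite_state := inferInstance
  trans := P.trans
  init := .boot
  final := Control.ready '' P.final

variable {P : ReactiveProgram.{u, v, w} Act Γ}

theorem silentStep_boot (t : Tape Γ) :
    P.toStayRTM.lts.SilentStep (.boot, t) (P.entry (.inl P.start), t.write P.seed) :=
  StayRTM.silentStep_write (fun ⟨_, _, h⟩ => nomatch h) rfl

theorem silentStep_run {p : P.Query} {c c' : TM0.Cfg Γ (P.subroutine p).Label}
    (h : c' ∈ TM0.step (P.subroutine p).machine c) :
    P.toStayRTM.lts.SilentStep (.run p c.q, c.Tape) (.run p c'.q, c'.Tape) := by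
  have hfinal : Control.run p c.q ∉ P.toStayRTM.final := fun ⟨_, _, h⟩ => nomatch h
  obtain ⟨⟨q, stmt⟩, hq : (P.subroutine p).machine c.q c.Tape.head = _, rfl⟩ :=
    Option.map_eq_some_iff.1 h
  cases stmt with
  | move dir => exact StayRTM.silentStep_move hfinal (by simp only [toStayRTM, trans, hq])
  | write b => exact StayRTM.silentStep_write hfinal (by simp only [toStayRTM, trans, hq])

theorem silentStep_halt {p : P.Query} {c : TM0.Cfg Γ (P.subroutine p).Label}
    (h : TM0.step (P.subroutine p).machine c = none) :
    P.toStayRTM.lts.SilentStep (.run p c.q, c.Tape) (.branch p, c.Tape.move .right) := by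
  have hq : (P.subroutine p).machine c.q c.Tape.head = none := Option.map_eq_none_iff.1 h
  exact StayRTM.silentStep_move (fun ⟨_, _, h⟩ => nomatch h)
    (by simp only [toStayRTM, trans, hq])

theorem silentStep_branch (p : P.Query) (t : Tape Γ) :
    P.toStayRTM.lts.SilentStep (.branch p, t) (P.entry (P.next p t.head), t.move .left) :=
  StayRTM.silentStep_move (fun ⟨_, _, h⟩ => nomatch h) rfl

/-- The execution of one query. -/
inductive QueryStep (P : ReactiveProgram.{u, v, w} Act Γ) :
    (P.Query ⊕ P.Ready) × Tape Γ → (P.Query ⊕ P.Ready) × Tape Γ → Prop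
  | intro {p : P.Query} {t t' : Tape Γ} (h : (P.subroutine p).Transforms t t') :
    QueryStep P (.inl p, t) (P.next p (t'.move .right).head, t')

/-- The execution of finitely many queries. -/
def Computes (P : ReactiveProgram.{u, v, w} Act Γ) :
    (P.Query ⊕ P.Ready) × Tape Γ → (P.Query ⊕ P.Ready) × Tape Γ → Prop :=
  Relation.ReflTransGen P.QueryStep

theorem silentReach_of_transforms {p : P.Query} {t t' : Tape Γ}
    (h : (P.subroutine p).Transforms t t') :
    P.toStayRTM.lts.SilentReach (.run p default, t)
      (P.entry (P.next p (t'.move .right).head), t') := by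
  obtain ⟨c, hc, rfl⟩ := h
  obtain ⟨hreach, hhalt⟩ := StateTransition.mem_eval.1 hc
  have hrun : P.toStayRTM.lts.SilentReach (.run p default, t) (.run p c.q, c.Tape) :=
    hreach.lift (fun c : TM0.Cfg Γ (P.subroutine p).Label => (Control.run p c.q, c.Tape))
      fun _ _ h => silentStep_run h
  have hbranch := silentStep_branch p (c.Tape.move .right)
  rw [Tape.move_right_left] at hbranch
  exact (hrun.tail (silentStep_halt hhalt)).tail hbranch

theorem Computes.silentReach {x y : (P.Query ⊕ P.Ready) × Tape Γ} (h : P.Computes x y) :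
    P.toStayRTM.lts.SilentReach (P.entry x.1, x.2) (P.entry y.1, y.2) := by
  induction h with
  | refl => exact .refl
  | tail _ hstep ih =>
    obtain ⟨htransforms⟩ := hstep
    exact ih.trans (silentReach_of_transforms htransforms)

/-- `P` executes `T` when `D e t s` says that `P`, being in the ready state `e` with the tape `t`,
is in the state `s` of `T`. -/
structure Implements (P : ReactiveProgram.{u, v, w} Act Γ) {T : TransitionSystem.{u, x} Act}
    (D : P.Ready → Tape Γ → T.State → Prop) : Prop where
  init : ∃ e t, P.Computes (.inl P.start, (default : Tape Γ).write P.seed) (.inr e, t) ∧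
    D e t T.init
  mem_final_iff : ∀ {e t s}, D e t s → (e ∈ P.final ↔ s ∈ T.final)
  isSome_react_iff : ∀ {e t s}, D e t s → ∀ a, (P.react e a).isSome ↔ ∃ s', T.step s a s'
  step : ∀ {e t s a p s'}, D e t s → P.react e a = some p → T.step s a s' →
    ∃ e' t', P.Computes (.inl p, t) (.inr e', t') ∧ D e' t' s'

theorem step_ready_iff {e : P.Ready} {t : Tape Γ} {a : ActTau Act} {c : P.toStayRTM.lts.State} :
    P.toStayRTM.lts.step (.ready e, t) a c ↔
      ∃ p, P.react e a = some p ∧ c = (P.entry (.inl p), t) := by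
  obtain ⟨s, t'⟩ := c
  constructor
  · rintro ⟨b, o, htrans, rfl⟩
    obtain ⟨p, hp, heq⟩ := Option.map_eq_some_iff.1 htrans
    cases heq
    exact ⟨p, hp, Prod.ext rfl (Tape.write_self _)⟩
  · rintro ⟨p, hp, heq⟩
    cases heq
    refine ⟨t.head, none, ?_, (Tape.write_self t).symm⟩
    simp [toStayRTM, trans, hp]

namespace Implements

variable {T : TransitionSystem.{u, x} Act} {D : P.Ready → Tape Γ → T.State → Prop}

theorem isSilentRefinement (h : P.Implements D) :
    IsSilentRefinement P.toStayRTM.lts T fun c s => ∃ e, c.1 = .ready e ∧ D e c.2 s where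
  init := by
    obtain ⟨e, t, hcomp, hD⟩ := h.init
    exact ⟨_, hcomp.silentReach.head (silentStep_boot _), e, rfl, hD⟩
  mem_final_iff := by
    rintro ⟨_, t⟩ s ⟨e, rfl, hD⟩
    refine Iff.trans ?_ (h.mem_final_iff hD)
    exact Function.Injective.mem_set_image fun _ _ => Control.ready.inj
  forth := by
    rintro ⟨_, t⟩ s a c ⟨e, rfl, hD⟩ hstep
    obtain ⟨p, hp, rfl⟩ := step_ready_iff.1 hstep
    obtain ⟨s', hs'⟩ := (h.isSome_react_iff hD a).1 (Option.isSome_of_eq_some hp)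
    obtain ⟨e', t', hcomp, hD'⟩ := h.step hD hp hs'
    exact ⟨s', hs', _, hcomp.silentReach, e', rfl, hD'⟩
  back := by
    rintro ⟨_, t⟩ s a s' ⟨e, rfl, hD⟩ hs'
    obtain ⟨p, hp⟩ := Option.isSome_iff_exists.1 ((h.isSome_react_iff hD a).2 ⟨s', hs'⟩)
    obtain ⟨e', t', hcomp, hD'⟩ := h.step hD hp hs'
    exact ⟨_, step_ready_iff.2 ⟨p, hp, rfl⟩, _, hcomp.silentReach, e', rfl, hD'⟩

theorem exists_rtm (h : P.Implements D) (hP : ∀ e, TauExclusive (P.react e)) :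
    ∃ M : RTM.{u, v, w} Act Γ, M.Deterministic ∧ DivPresBranchingBisimilar M.lts T := by
  have hdet := StayRTM.toRTM_deterministic (N := P.toStayRTM) (tauExclusive_trans hP)
  have hrefine := P.toStayRTM.isSilentRefinement_represents.comp h.isSilentRefinement
  exact ⟨_, hdet, hrefine.divPresBranchingBisimilar hdet.lts⟩

end Implements

end ReactiveProgram

/-! ### Interpreters of transition systems -/

/-- Subroutines that execute a transition system with `k` actions on a tape that represents its
current state: `start` sets up the initial state, `move j` performs the action number `j`, and
`ask i` answers the question number `i`, the answer being read by `test` one cell to the right of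
the head. Question `0` is whether the state is final, and question `j + 1` whether the action number
`j` is enabled. -/
structure Interpreter (k : ℕ) (Γ : Type w) where
  seed : Γ
  test : Γ → Bool
  start : FiniteTM0.{0, w} Γ
  move : Fin k → FiniteTM0.{0, w} Γ
  ask : Fin (k + 1) → FiniteTM0.{0, w} Γ

section Menu

open Classical in
/-- The answers to the questions asked by an `Interpreter`, with the actions numbered by `e`. -/
noncomputable def TransitionSystem.menu {Act : Type u} {k : ℕ} (T : TransitionSystem.{u, v} Act)
    (e : ActTau Act ≃ Fin k) (s : T.State) : Fin (k + 1) → Bool :=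
  Fin.cons (decide (s ∈ T.final)) fun j => decide (∃ s', T.step s (e.symm j) s')

variable {Act : Type u} {k : ℕ} {T : TransitionSystem.{u, v} Act} {e : ActTau Act ≃ Fin k}
  {s : T.State}

theorem TransitionSystem.menu_zero_eq_true_iff : T.menu e s 0 = true ↔ s ∈ T.final := by
  simp [menu]

theorem TransitionSystem.menu_succ_eq_true_iff {a : ActTau Act} :
    T.menu e s (e a).succ = true ↔ ∃ s', T.step s a s' := by
  simp [menu]

end Menu

section AnswersBefore

variable {k : ℕ}

/-- The answers to the questions before `i`, with all other entries still `false`. -/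
def answersBefore (answers : Fin (k + 1) → Bool) (i : Fin (k + 1)) : Fin (k + 1) → Bool :=
  fun j => decide (j < i) && answers j

variable (answers : Fin (k + 1) → Bool)

theorem answersBefore_zero : answersBefore answers 0 = fun _ => false := by
  funext j
  simp [answersBefore]

theorem update_answersBefore_last :
    Function.update (answersBefore answers (.last k)) (.last k) (answers (.last k)) = answers :=
  Function.update_eq_iff.2 ⟨rfl, fun j hj => by simp [answersBefore, Fin.lt_last_iff_ne_last.2 hj]⟩

theorem update_answersBefore_castSucc (i : Fin k) :
    Function.update (answersBefore answers i.castSucc) i.castSucc (answers i.castSucc) =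
      answersBefore answers i.succ := by
  refine Function.update_eq_iff.2 ⟨by simp [answersBefore], fun j hj => ?_⟩
  have hlt : j < i.castSucc ↔ j < i.succ := by
    rw [← Fin.le_castSucc_iff]
    exact ⟨le_of_lt, fun h => lt_of_le_of_ne h hj⟩
  simp only [answersBefore, hlt]

end AnswersBefore

namespace Interpreter

variable {k : ℕ} {Γ : Type w}

/-- The queries of the program of an `Interpreter`. A question carries the answers to the previous
questions. -/
inductive Query (k : ℕ) : Type
  | start : Query k
  | move (j : Fin k) : Query k
  | ask (i : Fin (k + 1)) (answers : Fin (k + 1) → Bool) : Query k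

instance : Finite (Query k) :=
  Finite.of_injective (β := Option (Fin k ⊕ Fin (k + 1) × (Fin (k + 1) → Bool)))
    (fun
      | .start => none
      | .move j => some (.inl j)
      | .ask i answers => some (.inr (i, answers)))
    (by rintro (_ | _ | _) (_ | _ | _) <;> simp)

variable {Act : Type u}

/-- The program that sets up the initial state and then repeatedly asks all the questions, offers
the enabled actions, and performs the action that is executed. Even on answers that do not come from
a deterministic transition system it offers nothing besides `τ` if `τ` is enabled. -/
def program (I : Interpreter k Γ) (e : ActTau Act ≃ Fin k) : ReactiveProgram.{u, 0, w} Act Γ where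
  Query := Query k
  Ready := Fin (k + 1) → Bool
  finite_query := inferInstance
  finite_ready := inferInstance
  subroutine
    | .start => I.start
    | .move j => I.move j
    | .ask i _ => I.ask i
  next
    | .ask i answers, b =>
      if h : i = Fin.last k then .inr (Function.update answers i (I.test b))
      else .inl (.ask (i.castPred h).succ (Function.update answers i (I.test b)))
    | _, _ => .inl (.ask 0 fun _ => false)
  seed := I.seed
  start := .start
  react answers a :=
    if answers (e a).succ = true ∧ (a.isSome → answers (e tau).succ = false) then
      some (.move (e a))
    else none
  final := {answers | answers 0 = true}

theorem tauExclusive_program_react (I : Interpreter k Γ) (e : ActTau Act ≃ Fin k)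
    (answers : Fin (k + 1) → Bool) : TauExclusive ((I.program e).react answers) := by
  intro a ha htau
  have hanswer : answers (e tau).succ = true := by
    by_contra hanswer
    simp [program, hanswer] at htau
  simp [program, hanswer, Option.isSome_iff_ne_none.2 ha]

variable {I : Interpreter k Γ} {T : TransitionSystem.{u, v} Act} {e : ActTau Act ≃ Fin k}

theorem react_menu_eq_some_iff (hT : T.Deterministic) {s : T.State} {a : ActTau Act}
    {q : Query k} : (I.program e).react (T.menu e s) a = some q ↔
      (∃ s', T.step s a s') ∧ .move (e a) = q := by
  have htau : (∃ s', T.step s a s') → a.isSome → T.menu e s (e tau).succ = false := by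
    rintro ⟨s', hs'⟩ ha
    rw [← Bool.not_eq_true, TransitionSystem.menu_succ_eq_true_iff]
    rintro ⟨s'', hs''⟩
    exact hT.2 _ _ hs'' ⟨a, s', Option.isSome_iff_ne_none.1 ha, hs'⟩
  simp only [program, TransitionSystem.menu_succ_eq_true_iff, Option.ite_none_right_eq_some,
    Option.some.injEq, and_iff_left_of_imp htau]

variable [Inhabited Γ] {Repr : T.State → Tape Γ → Prop}

/-- The subroutines of `I` do what their names say for `T`, where `Repr s t` says that the tape `t`
represents the state `s` and `e` numbers the actions. -/
structure IsCorrectFor (I : Interpreter k Γ) (T : TransitionSystem.{u, v} Act)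
    (e : ActTau Act ≃ Fin k) (Repr : T.State → Tape Γ → Prop) : Prop where
  start : ∃ t, I.start.Transforms ((default : Tape Γ).write I.seed) t ∧ Repr T.init t
  move : ∀ {s a s' t}, Repr s t → T.step s a s' →
    ∃ t', (I.move (e a)).Transforms t t' ∧ Repr s' t'
  ask : ∀ {s t}, Repr s t → ∀ i, ∃ t', (I.ask i).Transforms t t' ∧ Repr s t' ∧
    I.test (t'.move .right).head = T.menu e s i

namespace IsCorrectFor

theorem exists_computes_of_ask (h : I.IsCorrectFor T e Repr) {s : T.State} (i : Fin (k + 1)) :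
    ∀ {t}, Repr s t → ∃ t',
      (I.program e).Computes (.inl (.ask i (answersBefore (T.menu e s) i)), t)
        (.inr (T.menu e s), t') ∧ Repr s t' := by
  induction i using Fin.reverseInduction with
  | last =>
    intro t ht
    obtain ⟨t', htrans, ht', htest⟩ := h.ask ht (.last k)
    have hstep := ReactiveProgram.QueryStep.intro (P := I.program e)
      (p := .ask (.last k) (answersBefore (T.menu e s) (.last k))) htrans
    simp only [program, dite_true, htest, update_answersBefore_last] at hstep
    exact ⟨t', .single hstep, ht'⟩
  | cast i ih =>
    intro t ht
    obtain ⟨t', htrans, ht', htest⟩ := h.ask ht i.castSucc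
    have hstep := ReactiveProgram.QueryStep.intro (P := I.program e)
      (p := .ask i.castSucc (answersBefore (T.menu e s) i.castSucc)) htrans
    simp only [program, Fin.castSucc_ne_last, dite_false, Fin.castPred_castSucc, htest,
      update_answersBefore_castSucc] at hstep
    obtain ⟨t'', hcomp, ht''⟩ := ih ht'
    exact ⟨t'', hcomp.head hstep, ht''⟩

theorem exists_computes_of_next (h : I.IsCorrectFor T e Repr) {s : T.State} {t t' : Tape Γ}
    {q : Query k} (hnext : ∀ b, (I.program e).next q b = .inl (.ask 0 fun _ => false))
    (htrans : ((I.program e).subroutine q).Transforms t t') (ht' : Repr s t') :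
    ∃ t'', (I.program e).Computes (.inl q, t) (.inr (T.menu e s), t'') ∧ Repr s t'' := by
  obtain ⟨t'', hcomp, ht''⟩ := h.exists_computes_of_ask 0 ht'
  have hstep := ReactiveProgram.QueryStep.intro htrans
  rw [hnext, ← answersBefore_zero (T.menu e s)] at hstep
  exact ⟨t'', hcomp.head hstep, ht''⟩

theorem implements (h : I.IsCorrectFor T e Repr) (hT : T.Deterministic) :
    (I.program e).Implements (T := T) fun answers t s => answers = T.menu e s ∧ Repr s t where
  init := by
    obtain ⟨t, htrans, ht⟩ := h.start
    obtain ⟨t', hcomp, ht'⟩ := h.exists_computes_of_next (q := .start) (fun _ => rfl) htrans ht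
    exact ⟨_, t', hcomp, rfl, ht'⟩
  mem_final_iff := by
    rintro _ t s ⟨rfl, -⟩
    exact TransitionSystem.menu_zero_eq_true_iff
  isSome_react_iff := by
    rintro _ t s ⟨rfl, -⟩ a
    refine ⟨fun ha => ((react_menu_eq_some_iff hT).1 (Option.some_get ha).symm).1, fun hs' => ?_⟩
    exact Option.isSome_of_eq_some ((react_menu_eq_some_iff hT).2 ⟨hs', rfl⟩)
  step := by
    rintro _ t s a q s' ⟨rfl, ht⟩ hreact hs'
    obtain ⟨-, rfl⟩ := (react_menu_eq_some_iff hT).1 hreact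
    obtain ⟨t', htrans, ht'⟩ := h.move ht hs'
    obtain ⟨t'', hcomp, ht''⟩ :=
      h.exists_computes_of_next (q := .move (e a)) (fun _ => rfl) htrans ht'
    exact ⟨_, t'', hcomp, rfl, ht''⟩

theorem exists_rtm (h : I.IsCorrectFor T e Repr) (hT : T.Deterministic) :
    ∃ M : RTM.{u, 0, w} Act Γ, M.Deterministic ∧ DivPresBranchingBisimilar M.lts T :=
  (h.implements hT).exists_rtm (I.tauExclusive_program_react e)

end IsCorrectFor

end Interpreter

/-! ### Subroutines for partial recursive functions -/

instance : Finite PartrecToTM2.K' :=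
  Finite.of_injective (β := Fin 4)
    (fun
      | .main => 0
      | .rev => 1
      | .aux => 2
      | .stack => 3)
    (by rintro (_ | _ | _ | _) (_ | _ | _ | _) <;> simp)

/-- The tape alphabet of the single-tape simulation of the four-stack machine that evaluates
`Turing.ToPartrec.Code`. -/
abbrev StackSymbol : Type := TM2to1.Γ' PartrecToTM2.K' fun _ => PartrecToTM2.Γ'

instance : Finite StackSymbol :=
  inferInstanceAs (Finite (Bool × (PartrecToTM2.K' → Option PartrecToTM2.Γ')))

/-- The tape `t` stores the list `v` on the main stack; the other stacks are empty. The head is at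
the bottom of the stacks. -/
def StoresList (v : List ℕ) (t : Tape StackSymbol) : Prop :=
  ∃ L : ListBlank (∀ _ : PartrecToTM2.K', Option PartrecToTM2.Γ'),
    (∀ k, L.map (proj k) =
      ListBlank.mk ((PartrecToTM2.K'.elim (PartrecToTM2.trList v) [] [] [] k).map some).reverse) ∧
    t = Tape.mk' ∅ (TM2to1.addBottom L)

/-- The bottom marker together with empty stacks. -/
def bottomSymbol : StackSymbol := (true, fun _ => none)

theorem storesList_nil : StoresList [] ((default : Tape StackSymbol).write bottomSymbol) :=
  ⟨default, fun k => by cases k <;> rfl, rfl⟩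

/-- Whether the main stack has the digit `1` at the level of the symbol `a`. Trailing entries of a
list are lowest on the stack, so one level above the bottom this tells the stored lists `[m, 1]` and
`[m, 0]` apart. -/
def mainDigitIsOne (a : StackSymbol) : Bool :=
  decide (a.2 .main = some .bit1)

theorem mainDigitIsOne_of_storesList {m : ℕ} {b : Bool} {t : Tape StackSymbol}
    (h : StoresList [m, b.toNat] t) : mainDigitIsOne (t.move .right).head = b := by
  obtain ⟨L, hL, rfl⟩ := h
  have hhead : (Tape.move .right (Tape.mk' ∅ (TM2to1.addBottom L))).head.2 .main =
      L.nth 1 .main := by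
    rw [← TM2to1.addBottom_nth_snd, Tape.move_right_mk', Tape.mk'_head, ListBlank.nth_succ,
      ListBlank.nth_zero]
  rw [mainDigitIsOne, hhead, TM2to1.stk_nth_val _ (hL _)]
  cases b
  · simp
  · have hone : PartrecToTM2.trNat 1 = [.bit1] := rfl
    simp [hone]

theorem exists_finiteTM0_eval (c : ToPartrec.Code) :
    ∃ m : FiniteTM0.{0, 0} StackSymbol, ∀ {v w t}, StoresList v t → w ∈ c.eval v →
      ∃ t', m.Transforms t t' ∧ StoresList w t' := by
  classical
  let : Inhabited PartrecToTM2.Λ' := ⟨PartrecToTM2.trNormal c .halt⟩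
  have hTM2 := PartrecToTM2.tr_supports c .halt
  have hTM1 := TM2to1.tr_supports PartrecToTM2.tr hTM2
  have hTM0 := TM1to0.tr_supports (TM2to1.tr PartrecToTM2.tr) hTM1
  refine ⟨.restrict _ (Finset.finite_toSet _) hTM0, ?_⟩
  rintro v w t ⟨L, hL, rfl⟩ hw
  have hw₂ : PartrecToTM2.halt w ∈
      StateTransition.eval (TM2.step PartrecToTM2.tr) (PartrecToTM2.init c v) := by
    rw [PartrecToTM2.tr_eval]
    exact Part.mem_map _ hw
  obtain ⟨_, ⟨L', hL'⟩, hw₁⟩ := StateTransition.tr_eval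
    (TM2to1.tr_respects PartrecToTM2.tr) (TM2to1.TrCfg.mk (q := _) (v := _) L hL) hw₂
  obtain ⟨_, rfl, hw₀⟩ := StateTransition.tr_eval
    (TM1to0.tr_respects (TM2to1.tr PartrecToTM2.tr)) rfl hw₁
  exact ⟨_, FiniteTM0.restrict_transforms _ hTM0 hw₀, L', hL', rfl⟩

theorem exists_code_pair {f g : ℕ →. ℕ} (hf : Partrec f) (hg : Partrec g) :
    ∃ c : ToPartrec.Code, ∀ {v : List ℕ} {m n : ℕ}, m ∈ f v.headI → n ∈ g v.headI →
      [m, n] ∈ c.eval v := by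
  obtain ⟨cf, hcf⟩ := ToPartrec.Code.exists_code (Nat.Partrec'.part_iff₁.2 hf)
  obtain ⟨cg, hcg⟩ := ToPartrec.Code.exists_code (Nat.Partrec'.part_iff₁.2 hg)
  refine ⟨(cf.cons cg).comp .head, fun {v m n} hm hn => ?_⟩
  have hcfv : cf.eval [v.headI] = pure <$> f v.headI := hcf ⟨[v.headI], rfl⟩
  have hcgv : cg.eval [v.headI] = pure <$> g v.headI := hcg ⟨[v.headI], rfl⟩
  rw [Part.eq_some_iff.2 hm] at hcfv
  rw [Part.eq_some_iff.2 hn] at hcgv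
  simp [hcfv, hcgv]

theorem exists_finiteTM0_pair {f g : ℕ →. ℕ} (hf : Partrec f) (hg : Partrec g) :
    ∃ m : FiniteTM0.{0, 0} StackSymbol, ∀ {v t k n}, StoresList v t → k ∈ f v.headI →
      n ∈ g v.headI → ∃ t', m.Transforms t t' ∧ StoresList [k, n] t' := by
  obtain ⟨c, hc⟩ := exists_code_pair hf hg
  obtain ⟨m, hm⟩ := exists_finiteTM0_eval c
  exact ⟨m, fun ht hk hn => hm ht (hc hk hn)⟩

section ComputableOnCodes

variable {S : Type v} {code : S → ℕ}

/-- Some partial recursive function maps `code s` to `f s` for every `s`, whatever it does at the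
numbers that are not codes. -/
def ComputableOnCodes (code f : S → ℕ) : Prop :=
  ∃ g : ℕ →. ℕ, Partrec g ∧ ∀ s, f s ∈ g (code s)

theorem RecursiveUnderCoding.computableOnCodes {f : S → ℕ} (h : RecursiveUnderCoding code f) :
    ComputableOnCodes code f := by
  obtain ⟨g, hg, hgf, -⟩ := h
  exact ⟨g, Partrec.nat_iff.2 hg, fun s => Part.eq_some_iff.1 (hgf s)⟩

theorem ComputableOnCodes.comp {f : S → ℕ} {F : ℕ → ℕ} (hF : Computable F)
    (hf : ComputableOnCodes code f) : ComputableOnCodes code fun s => F (f s) := by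
  obtain ⟨g, hg, hgf⟩ := hf
  exact ⟨_, hg.map (hF.comp Computable.snd).to₂, fun s => Part.mem_map F (hgf s)⟩

/-- The tape stores the code of `s`, followed by one more number, which is scratch space for the
answers to questions about `s`. -/
def StoresCode (code : S → ℕ) (s : S) (t : Tape StackSymbol) : Prop :=
  ∃ n, StoresList [code s, n] t

variable (code) in
theorem exists_finiteTM0_store (s : S) : ∃ m : FiniteTM0.{0, 0} StackSymbol,
    ∃ t, m.Transforms ((default : Tape StackSymbol).write bottomSymbol) t ∧
      StoresCode code s t := by
  obtain ⟨m, hm⟩ := exists_finiteTM0_pair (f := fun _ => Part.some (code s))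
    (Computable.const _).partrec (Computable.const 0).partrec
  obtain ⟨t, htrans, ht⟩ := hm storesList_nil (Part.mem_some _) (Part.mem_some _)
  exact ⟨m, t, htrans, _, ht⟩

theorem exists_finiteTM0_update {f : S → ℕ} {F : ℕ →. ℕ} (hf : ComputableOnCodes code f)
    (hF : Partrec F) : ∃ m : FiniteTM0.{0, 0} StackSymbol, ∀ {s s' t}, StoresCode code s t →
      code s' ∈ F (f s) → ∃ t', m.Transforms t t' ∧ StoresCode code s' t' := by
  obtain ⟨g, hg, hgf⟩ := hf
  obtain ⟨m, hm⟩ := exists_finiteTM0_pair (hg.bind (hF.comp Computable.snd).to₂)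
    (Computable.const 0).partrec
  refine ⟨m, fun {s s' t} ⟨n, ht⟩ hs' => ?_⟩
  obtain ⟨t', htrans, ht'⟩ := hm ht (Part.mem_bind (hgf s) hs') (Part.mem_some _)
  exact ⟨t', htrans, _, ht'⟩

theorem exists_finiteTM0_decide {p : S → Bool}
    (hp : ComputableOnCodes code fun s => (p s).toNat) :
    ∃ m : FiniteTM0.{0, 0} StackSymbol, ∀ {s t}, StoresCode code s t →
      ∃ t', m.Transforms t t' ∧ StoresCode code s t' ∧
        mainDigitIsOne (t'.move .right).head = p s := by
  obtain ⟨g, hg, hgp⟩ := hp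
  obtain ⟨m, hm⟩ := exists_finiteTM0_pair Computable.id.partrec hg
  refine ⟨m, fun {s t} ⟨n, ht⟩ => ?_⟩
  obtain ⟨t', htrans, ht'⟩ := hm ht (Part.mem_some _) (hgp s)
  exact ⟨t', htrans, ⟨_, ht'⟩, mainDigitIsOne_of_storesList ht'⟩

end ComputableOnCodes

/-! ### Reading transitions off their codes -/

theorem testBit_finiteSetCode {X : Set ℕ} (hX : X.Finite) {x : ℕ} :
    (finiteSetCode X hX).testBit x = true ↔ x ∈ X := by
  rw [← Nat.mem_bitIndices, ← List.mem_toFinset, finiteSetCode,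
    Finset.toFinset_bitIndices_sum_two_pow, Set.Finite.mem_toFinset]

/-- `x` is the code of a pair with first component `c` in the finite set with code `K`. -/
def IsTransitionCode (c x K : ℕ) : Prop := K.testBit x = true ∧ x.unpair.1 = c

instance (c x K : ℕ) : Decidable (IsTransitionCode c x K) :=
  inferInstanceAs (Decidable (_ ∧ _))

theorem IsTransitionCode.lt {c x K : ℕ} (h : IsTransitionCode c x K) : x < K :=
  Nat.lt_two_pow_self.trans_le (Nat.ge_two_pow_of_testBit h.1)

theorem primrecRel_isTransitionCode (c : ℕ) : PrimrecRel (IsTransitionCode c) := by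
  have hpow : Primrec₂ ((· ^ ·) : ℕ → ℕ → ℕ) := Primrec₂.unpaired'.1 Nat.Primrec.pow
  have hbit : PrimrecRel fun x K : ℕ => K / 2 ^ x % 2 = 1 :=
    Primrec.eq.comp (Primrec.nat_mod.comp (Primrec.nat_div.comp Primrec.snd
      (hpow.comp (Primrec.const 2) Primrec.fst)) (Primrec.const 2)) (Primrec.const 1)
  have hfst : PrimrecRel fun x _ : ℕ => x.unpair.1 = c :=
    Primrec.eq.comp (Primrec.fst.comp (Primrec.unpair.comp Primrec.fst)) (Primrec.const c)
  refine (PrimrecPred.and hbit hfst).of_eq fun ⟨x, K⟩ => ?_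
  simp [IsTransitionCode, Nat.testBit_eq_decide_div_mod_eq]

/-- Whether the finite set with code `K` contains a pair with first component `c`. The search is
bounded because an element of a finite set is less than the code of the set. -/
def hasTransition (c K : ℕ) : Bool := decide (∃ x < K, IsTransitionCode c x K)

theorem hasTransition_iff {c K : ℕ} : hasTransition c K = true ↔ ∃ x, IsTransitionCode c x K := by
  simp only [hasTransition, decide_eq_true_iff]
  exact exists_congr fun x => and_iff_right_of_imp IsTransitionCode.lt

theorem computable_toNat_hasTransition (c : ℕ) : Computable fun K => (hasTransition c K).toNat := by
  have hexists : PrimrecPred fun K : ℕ => ∃ x < K, IsTransitionCode c x K :=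
    (primrecRel_isTransitionCode c).exists_lt.comp Primrec.id Primrec.id
  exact ((Primrec.dom_finite Bool.toNat).comp hexists.decide).to_comp

/-- The second component of the least pair with first component `c` in the finite set with
code `K`. -/
def targetCode (c K : ℕ) : Part ℕ :=
  (Nat.rfind fun x => Part.some (decide (IsTransitionCode c x K))).map fun x => x.unpair.2

theorem partrec_targetCode (c : ℕ) : Partrec (targetCode c) := by
  have hdecide : Partrec₂ fun K x : ℕ => Part.some (decide (IsTransitionCode c x K)) :=
    ((primrecRel_isTransitionCode c).decide.comp Primrec.snd Primrec.fst).to_comp.partrec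
  exact (Partrec.rfind hdecide).map
    (Computable.snd.comp (Computable.unpair.comp Computable.snd))

theorem mem_targetCode {c K m : ℕ} (hm : IsTransitionCode c (Nat.pair c m) K)
    (huniq : ∀ x, IsTransitionCode c x K → x = Nat.pair c m) : m ∈ targetCode c K := by
  refine (Part.mem_map_iff _).2 ⟨Nat.pair c m, ?_, by simp⟩
  obtain ⟨x, hx, -⟩ := Nat.rfind_min' (p := fun x => decide (IsTransitionCode c x K))
    (m := Nat.pair c m) (by simpa using hm)
  rwa [← huniq x (by simpa using Nat.rfind_spec hx)]

namespace TransitionSystem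

variable {Act : Type u} {T : TransitionSystem.{u, v} Act}

theorem toNat_menu_zero {k : ℕ} (e : ActTau Act ≃ Fin k) (s : T.State) :
    (T.menu e s 0).toNat = T.fin s := by
  by_cases h : s ∈ T.final <;> simp [menu, fin, h]

variable (hT : T.FinitelyBranching) {codeAct : ActTau Act → ℕ} (code : T.State → ℕ)

theorem isTransitionCode_outCode_iff (hAct : Function.Injective codeAct) {s : T.State}
    {a : ActTau Act} {x : ℕ} : IsTransitionCode (codeAct a) x (T.outCode hT codeAct code s) ↔
      ∃ t, T.step s a t ∧ x = Nat.pair (codeAct a) (code t) := by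
  rw [IsTransitionCode, outCode, testBit_finiteSetCode]
  constructor
  · rintro ⟨⟨⟨b, t⟩, hbt, rfl⟩, hx⟩
    obtain rfl := hAct ((congrArg Prod.fst (Nat.unpair_pair _ _)).symm.trans hx)
    exact ⟨t, hbt, rfl⟩
  · rintro ⟨t, ht, rfl⟩
    exact ⟨⟨(a, t), ht, rfl⟩, by simp⟩

theorem hasTransition_outCode (hAct : Function.Injective codeAct) {k : ℕ}
    (e : ActTau Act ≃ Fin k) (s : T.State) (a : ActTau Act) :
    hasTransition (codeAct a) (T.outCode hT codeAct code s) = T.menu e s (e a).succ := by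
  rw [Bool.eq_iff_iff, hasTransition_iff, menu_succ_eq_true_iff]
  simp only [isTransitionCode_outCode_iff hT code hAct]
  exact ⟨fun ⟨_, t, ht, _⟩ => ⟨t, ht⟩, fun ⟨t, ht⟩ => ⟨_, t, ht, rfl⟩⟩

theorem mem_targetCode_outCode (hdet : T.Deterministic) (hAct : Function.Injective codeAct)
    {s t : T.State} {a : ActTau Act} (ht : T.step s a t) :
    code t ∈ targetCode (codeAct a) (T.outCode hT codeAct code s) := by
  refine mem_targetCode ((isTransitionCode_outCode_iff hT code hAct).2 ⟨t, ht, rfl⟩) fun x hx => ?_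
  obtain ⟨t', ht', rfl⟩ := (isTransitionCode_outCode_iff hT code hAct).1 hx
  rw [hdet.1 _ _ _ _ ht ht']

end TransitionSystem

theorem mainTheorem9_general {Act : Type u} [Finite Act] (T : TransitionSystem.{u, v} Act)
    (hdet : T.Deterministic) (hT : T.FinitelyBranching) (codeAct : ActTau Act → ℕ)
    (code : T.State → ℕ) (hAct : Function.Injective codeAct)
    (hout : ComputableOnCodes code (T.outCode hT codeAct code))
    (hfin : ComputableOnCodes code T.fin) :
    ∃ (Data : Type) (_ : Finite Data) (M : RTM.{u, 0, 0} Act Data),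
      M.Deterministic ∧ DivPresBranchingBisimilar M.lts T := by
  obtain ⟨k, ⟨e⟩⟩ := Finite.exists_equiv_fin (ActTau Act)
  obtain ⟨start, hstart⟩ := exists_finiteTM0_store code T.init
  choose move hmove using fun j : Fin k =>
    exists_finiteTM0_update hout (partrec_targetCode (codeAct (e.symm j)))
  have hmenu (i : Fin (k + 1)) : ComputableOnCodes code fun s => (T.menu e s i).toNat := by
    refine Fin.cases (by simpa only [TransitionSystem.toNat_menu_zero]) (fun j => ?_) i
    obtain ⟨a, rfl⟩ := e.surjective j
    simpa only [TransitionSystem.hasTransition_outCode hT code hAct e] using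
      hout.comp (computable_toNat_hasTransition (codeAct a))
  choose ask hask using fun i => exists_finiteTM0_decide (hmenu i)
  let I : Interpreter k StackSymbol := ⟨bottomSymbol, mainDigitIsOne, start, move, ask⟩
  have hI : I.IsCorrectFor T e (StoresCode code) :=
    { start := hstart
      move := fun {s a s' t} ht hs' => hmove (e a) ht <| by
        simpa only [Equiv.symm_apply_apply] using
          TransitionSystem.mem_targetCode_outCode hT code hdet hAct hs'
      ask := fun ht i => hask i ht }
  exact ⟨StackSymbol, inferInstance, hI.exists_rtm hdet⟩

theorem mainTheorem9 {Act : Type u} [Finite Act] (T : TransitionSystem.{u, v} Act)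
    (hdet : T.Deterministic) (hcomp : T.IsComputable) :
    ∃ (Data : Type) (_ : Finite Data) (M : RTM.{u, 0, 0} Act Data),
      M.Deterministic ∧ DivPresBranchingBisimilar M.lts T := by
  obtain ⟨hT, codeAct, code, hAct, -, hout, hfin⟩ := hcomp
  exact mainTheorem9_general T hdet hT codeAct code hAct hout.computableOnCodes
    hfin.computableOnCodes
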